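/- Let $L$ be a real $d\times d$ matrix with $\det L\neq 0$, let $\mathcal L=L\mathbb Z^d$ and $\mathcal C=L[-\tfrac12,\tfrac12]^d$, and let $W_{\mathcal L}\in L^\infty(\mathbb R^d)$ be real and $\mathcal L$-periodic. Assume that all eigenvalues of $-\tfrac12\Delta+W_{\mathcal L}$ on $L^2(\mathcal C)$ with periodic boundary conditions are simple; let $E_0<E_1<\dots$ be these eigenvalues and $(v_n)_{n\in\mathbb N}$ an orthonormal basis of $L^2(\mathcal C)$ of corresponding ($\mathcal L$-periodic) eigenfunctions. Put $\omega_{nn'}=E_n-E_{n'}$, $$P_{nn'}=\int_{\mathcal C}\overline{v_n}\,\nabla v_{n'}\,dz,\qquad \mathbb M_n^{-1}=I-2\sum_{n'\neq n}\frac{P_{nn'}\otimes P_{n'n}}{E_n-E_{n'}} .$$ Let $\mu>0$ and let $V\in\mathcal W_\mu$, that is, $V=V(x,z)\in L^\infty(\mathbb R^{d}\times\mathbb R^d)$ is real, $\mathcal L$-periodic in $z$, and $$\operatorname*{ess\,sup}_{z\in\mathcal C}\int_{\mathbb R^d}(1+|k|)^\mu\,|\widehat V(k,z)|\,dk<\infty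 ,$$ where $\widehat V(\cdot,z)$ is the (distributional) Fourier transform of $V(\cdot,z)$; put $V_{nn'}(x)=\int_{\mathcal C}\overline{v_n(z)}\,v_{n'}(z)\,V(x,z)\,dz$. Let $\mathcal L^2=\ell^2(\mathbb N,L^2(\mathbb R^d))$ and $\mathcal H^\mu=\ell^2(\mathbb N,H^\mu(\mathbb R^d))$, and let $f^{in,\epsilon}\in\mathcal L^2$ $(\epsilon>0)$ and $f^{in}\in\mathcal L^2$ be such that $f^{in,\epsilon}$ is bounded in $\mathcal H^\mu$ uniformly as $\epsilon\to0^+$ and $\lim_{\epsilon\to0^+}\|f^{in,\epsilon}-f^{in}\|_{\mathcal L^2}=0$. Then, for every $\epsilon>0$, the system $$i\partial_t h^\epsilon_n=-\tfrac12\operatorname{div}(\mathbb M_n^{-1}\nabla h^\epsilon_n)+\sum_{n'}e^{i\omega_{nn'}t/\epsilon^2}V_{nn'}h^\epsilon_{n'},\qquad h^\epsilon_n(0)=f^{in,\epsilon}_n,\qquad n\in\mathbb N,$$ and the decoupled system $$i\partial_t h_n=-\tfrac12\operatorname{div}(\mathbb M_n^{-1}\nabla h_n)+V_{nn}h_n,\qquad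 h_n(0)=f^{in}_n,\qquad n\in\mathbb N,$$ each have exactly one mild solution $h^\epsilon$, respectively $h$, in $C([0,\infty),\mathcal L^2)$ (a mild solution is a continuous function that satisfies the Duhamel formula with respect to the unitary groups $e^{\frac{it}{2}\operatorname{div}(\mathbb M_n^{-1}\nabla)}$), and $$\lim_{\epsilon\to0^+}\ \sup_{0\le t\le\tau}\|h^\epsilon(t)-h(t)\|_{\mathcal L^2}=0\qquad\text{for every }\tau\ge 0 .$$ -/

import Mathlib

open MeasureTheory Set Filter Topology FourierTransform
open scoped ENNReal NNReal ComplexConjugate SchwartzMap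

noncomputable section

/-- Position (and wave vector) space `ℝ^d` with the Euclidean norm. -/
abbrev Pos (d : ℕ) : Type := EuclideanSpace ℝ (Fin d)

/-- `L²(ℝ^d)`, complex valued. -/
abbrev L2Space (d : ℕ) : Type := Lp ℂ 2 (volume : Measure (Pos d))

/-- `ℓ²(ℕ, L²(ℝ^d))`, the space of sequences of envelope functions. -/
abbrev EnvSpace (d : ℕ) : Type := lp (fun _ : ℕ => L2Space d) 2

/-! ### The lattice and the Bloch functions at zero wave vector -/

/-- The lattice vector `L m`, `m ∈ ℤ^d`. -/
def latticeVec {d : ℕ} (L : Matrix (Fin d) (Fin d) ℝ) (m : Fin d → ℤ) : Pos d :=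
  WithLp.toLp 2 (L.mulVec fun i => (m i : ℝ))

/-- The centered fundamental cell `{L t | t ∈ [-1/2, 1/2]^d}`. -/
def cell {d : ℕ} (L : Matrix (Fin d) (Fin d) ℝ) : Set (Pos d) :=
  {z | ∃ t : Fin d → ℝ, (∀ i, t i ∈ Icc (-(1 / 2) : ℝ) (1 / 2)) ∧
    z = WithLp.toLp 2 (L.mulVec t)}

/-- Almost everywhere periodicity with respect to the lattice `L ℤ^d`. -/
def LatticePeriodic {d : ℕ} {F : Type*} (L : Matrix (Fin d) (Fin d) ℝ) (u : Pos d → F) : Prop :=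
  ∀ m : Fin d → ℤ, ∀ᵐ z : Pos d, u (z + latticeVec L m) = u z

/-- The partial derivative `∂_j φ` of a test function. -/
def partialDeriv {d : ℕ} (j : Fin d) (φ : Pos d → ℂ) (z : Pos d) : ℂ :=
  fderiv ℝ φ z (EuclideanSpace.single j 1)

/-- Smooth, compactly supported test functions on `ℝ^d`. -/
def IsTestFunction {d : ℕ} (φ : Pos d → ℂ) : Prop :=
  ContDiff ℝ (⊤ : ℕ∞) φ ∧ HasCompactSupport φ

/-- `Du` is the weak gradient of `u` on `ℝ^d`. -/
def HasWeakGradient {d : ℕ} (u : Pos d → ℂ) (Du : Fin d → Pos d → ℂ) : Prop :=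
  LocallyIntegrable u ∧ (∀ j, LocallyIntegrable (Du j)) ∧
    ∀ φ : Pos d → ℂ, IsTestFunction φ → ∀ j,
      (∫ z, u z * partialDeriv j φ z) = -(∫ z, Du j z * φ z)

/-- `(E n, v n)` is the complete system of eigenpairs of `-½ Δ + W` on the cell with periodic
boundary conditions, all eigenvalues being simple and listed in increasing order: the `v n` are
periodic, of class `H¹` on the cell with weak gradient `Dv n`, solve
`-½ Δ v n + W v n = E n v n` weakly, and form an orthonormal basis of `L²` of the cell. -/
structure IsBlochSystem {d : ℕ} (L : Matrix (Fin d) (Fin d) ℝ) (W : Pos d → ℝ)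
    (E : ℕ → ℝ) (v : ℕ → Pos d → ℂ) (Dv : ℕ → Fin d → Pos d → ℂ) : Prop where
  strictMono : StrictMono E
  periodic : ∀ n, LatticePeriodic L (v n)
  memLp : ∀ n, MemLp (v n) 2 (volume.restrict (cell L))
  weakGradient : ∀ n, HasWeakGradient (v n) (Dv n)
  memLp_gradient : ∀ n j, MemLp (Dv n j) 2 (volume.restrict (cell L))
  eigen : ∀ n, ∀ φ : Pos d → ℂ, IsTestFunction φ →
    (1 / 2 : ℂ) * (∑ j, ∫ z, Dv n j z * partialDeriv j φ z) + (∫ z, (W z : ℂ) * v n z * φ z)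
      = (E n : ℂ) * (∫ z, v n z * φ z)
  orthonormal : ∀ n m, ∫ z in cell L, conj (v n z) * v m z = if n = m then 1 else 0
  complete : ∀ f : Pos d → ℂ, MemLp f 2 (volume.restrict (cell L)) →
    (∀ n, ∫ z in cell L, conj (v n z) * f z = 0) → f =ᵐ[volume.restrict (cell L)] 0

/-- The `j`-th component of `P_{nm} = ∫_C conj(v_n) ∇ v_m`. -/
def momentumElement {d : ℕ} (L : Matrix (Fin d) (Fin d) ℝ) (v : ℕ → Pos d → ℂ)
    (Dv : ℕ → Fin d → Pos d → ℂ) (n m : ℕ) (j : Fin d) : ℂ :=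
  ∫ z in cell L, conj (v n z) * Dv m j z

/-- The inverse effective mass tensor of the `n`-th band,
`I - 2 ∑_{m ≠ n} P_{nm} ⊗ P_{mn} / (E_n - E_m)`. For a Bloch system its entries are real numbers,
since each `v n` is a real function up to a constant phase; `re` only changes their type. -/
def inverseMass {d : ℕ} (L : Matrix (Fin d) (Fin d) ℝ) (E : ℕ → ℝ) (v : ℕ → Pos d → ℂ)
    (Dv : ℕ → Fin d → Pos d → ℂ) (n : ℕ) : Matrix (Fin d) (Fin d) ℝ :=
  fun i j => ((if i = j then 1 else 0) - 2 * ∑' m : ℕ, if m = n then 0 else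
    momentumElement L v Dv n m i * momentumElement L v Dv m n j / ((E n : ℂ) - (E m : ℂ)) : ℂ).re

/-! ### The external potential -/

/-- The class `𝒲_μ` of external potentials `V(x, z)`: bounded on `ℝ^d × ℝ^d`, periodic in `z`, and
such that, for a.e. `z` in the cell, the (distributional) Fourier transform of `V(·, z)` is a
function with `∫ (1 + |k|)^μ |V̂(k, z)| dk` bounded uniformly in `z`. Here `G` is the Fourier
transform in the normalization `∫ e^{-2π i ξ·x} V(x, z) dx`, so that `k = 2π ξ`. -/
def MemPotentialClass {d : ℕ} (L : Matrix (Fin d) (Fin d) ℝ) (μ : ℝ)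
    (V : Pos d → Pos d → ℝ) : Prop :=
  MemLp (Function.uncurry V) ⊤ (volume : Measure (Pos d × Pos d)) ∧
  (∀ m : Fin d → ℤ, ∀ᵐ p : Pos d × Pos d, V p.1 (p.2 + latticeVec L m) = V p.1 p.2) ∧
  ∃ K : ℝ≥0, ∀ᵐ z ∂(volume.restrict (cell L)), ∃ G : Pos d → ℂ, Integrable G ∧
    (∀ φ : 𝓢(Pos d, ℂ), (∫ x, (V x z : ℂ) * (𝓕 φ) x) = ∫ ξ, G ξ * φ ξ) ∧
    (∫⁻ ξ, ENNReal.ofReal ((1 + 2 * Real.pi * ‖ξ‖) ^ μ) * ‖G ξ‖ₑ) ≤ K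

/-- The matrix potential `V_{nm}(x) = ∫_C conj(v_n(z)) v_m(z) V(x, z) dz`. -/
def potentialMatrix {d : ℕ} (L : Matrix (Fin d) (Fin d) ℝ) (v : ℕ → Pos d → ℂ)
    (V : Pos d → Pos d → ℝ) (n m : ℕ) (x : Pos d) : ℂ :=
  ∫ z in cell L, conj (v n z) * v m z * (V x z : ℂ)

/-! ### The evolution equations -/

/-- The squared norm of `ℓ²(ℕ, H^μ(ℝ^d))`, that is `∑_n ∫ (1 + |k|²)^μ |f̂_n(k)|² dk` with the
unitary Fourier transform in `k`, written in the variable `ξ = k / 2π`. -/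
def sobolevNormSq {d : ℕ} (μ : ℝ) (f : EnvSpace d) : ℝ≥0∞ :=
  ∑' n, ∫⁻ ξ, ENNReal.ofReal ((1 + ‖(2 * Real.pi) • ξ‖ ^ 2) ^ μ) *
    ‖(𝓕 (f n) : L2Space d) ξ‖ₑ ^ 2

open Classical in
/-- The pointwise product of an `L²` function with a bounded measurable function `a`
(zero if the product is not in `L²`, which does not happen for such `a`). -/
def mulL2 {d : ℕ} (a : Pos d → ℂ) (f : L2Space d) : L2Space d :=
  if h : MemLp (fun x => a x * f x) 2 volume then h.toLp _ else 0

/-- The unitary group `exp (i t/2 div(M ∇))` on `L²(ℝ^d)`, i.e. multiplication of the Fourier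
transform by `exp (-i t/2 k·M k)`, with `k = 2π ξ`. -/
def freeGroup {d : ℕ} (M : Matrix (Fin d) (Fin d) ℝ) (t : ℝ) (f : L2Space d) : L2Space d :=
  𝓕⁻ (mulL2 (fun ξ : Pos d => Complex.exp (-(Complex.I * (t / 2 : ℝ) *
    (((2 * Real.pi) • ξ).ofLp ⬝ᵥ M.mulVec ((2 * Real.pi) • ξ).ofLp : ℝ)))) (𝓕 f))

/-- `h : [0, ∞) → ℓ²(L²)` is a mild solution of the system
`i ∂_t h_n = -½ div(M_n ∇ h_n) + (B(t) h)_n`, `h(0) = f`: it is continuous and satisfies the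
variation of constants formula. -/
def IsMildSolution {d : ℕ} (M : ℕ → Matrix (Fin d) (Fin d) ℝ)
    (B : ℝ → EnvSpace d → ℕ → L2Space d) (f : EnvSpace d) (h : ℝ → EnvSpace d) : Prop :=
  ContinuousOn h (Ici 0) ∧ ∀ t, 0 ≤ t → ∀ n,
    h t n = freeGroup (M n) t (f n)
      - Complex.I • ∫ s in (0 : ℝ)..t, freeGroup (M n) (t - s) (B s (h s) n)

/-- The rapidly oscillating coupling
`(B^ε(t) h)_n = ∑_m exp(i (E_n - E_m) t / ε²) V_{nm} h_m`. -/
def oscillatingCoupling {d : ℕ} (E : ℕ → ℝ) (U : ℕ → ℕ → Pos d → ℂ) (ε : ℝ)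
    (t : ℝ) (h : EnvSpace d) (n : ℕ) : L2Space d :=
  ∑' m, Complex.exp (Complex.I * (((E n - E m) * t / ε ^ 2 : ℝ) : ℂ)) • mulL2 (U n m) (h m)

/-- The decoupled potential `(B h)_n = V_{nn} h_n`. -/
def diagonalCoupling {d : ℕ} (U : ℕ → ℕ → Pos d → ℂ)
    (_t : ℝ) (h : EnvSpace d) (n : ℕ) : L2Space d :=
  mulL2 (U n n) (h n)

/-- Existence, and uniqueness on `[0, ∞)`, of the mild solution. -/
def HasUniqueMildSolution {d : ℕ} (M : ℕ → Matrix (Fin d) (Fin d) ℝ)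
    (B : ℝ → EnvSpace d → ℕ → L2Space d) (f : EnvSpace d) : Prop :=
  ∃ h, IsMildSolution M B f h ∧ ∀ h', IsMildSolution M B f h' → EqOn h' h (Ici 0)

end

/-!
Write both systems in the interaction picture, as Volterra equations `y = f + ∫ A(s) y(s) ds` with
bounded, strongly continuous coefficients; these have unique solutions by a contraction argument.
By Gronwall's lemma, the difference of two solutions is controlled by the integral of the
difference of the coefficients along the limit trajectory alone. The diagonal couplings cancel in
that difference. Since the eigenvalues are simple, each off-diagonal coupling carries a phase
`exp (i (E_n - E_m) s / ε²)` with nonzero frequency, and averages to zero along a fixed continuous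
curve by the Riemann–Lebesgue lemma. Equicontinuity makes the convergence uniform in time.
-/

noncomputable section

/-! ### Strongly continuous families of operators -/

section StronglyContinuous

variable {𝕜 T T' X Y Z : Type*} [NontriviallyNormedField 𝕜] [TopologicalSpace T]
  [TopologicalSpace T'] [NormedAddCommGroup X] [NormedSpace 𝕜 X] [NormedAddCommGroup Y]
  [NormedSpace 𝕜 Y] [NormedAddCommGroup Z] [NormedSpace 𝕜 Z]

/-- `A` is a strongly continuous family of bounded operators with uniform norm bound `C`. -/
structure StronglyContinuousWith (C : ℝ≥0) (A : T → X →L[𝕜] Y) : Prop where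
  norm_le : ∀ t, ‖A t‖ ≤ C
  continuous_apply_const : ∀ x, Continuous fun t => A t x

namespace StronglyContinuousWith

variable {A B : T → X →L[𝕜] Y} {C D : ℝ≥0}

theorem norm_apply_le (hA : StronglyContinuousWith C A) (t : T) (x : X) : ‖A t x‖ ≤ C * ‖x‖ :=
  (A t).le_of_opNorm_le (hA.norm_le t) x

theorem continuous_apply (hA : StronglyContinuousWith C A) {y : T → X} (hy : Continuous y) :
    Continuous fun t => A t (y t) :=
  (continuous_prod_of_continuous_lipschitzWith' (fun p : T × X => A p.1 p.2) C
    (fun t => (A t).lipschitz.weaken (hA.norm_le t)) hA.continuous_apply_const).comp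
    (continuous_id.prodMk hy)

theorem const (A : X →L[𝕜] Y) : StronglyContinuousWith ‖A‖₊ fun _ : T => A :=
  ⟨fun _ => le_rfl, fun _ => continuous_const⟩

theorem comp_continuous (hA : StronglyContinuousWith C A) {a : T' → T} (ha : Continuous a) :
    StronglyContinuousWith C fun t => A (a t) :=
  ⟨fun t => hA.norm_le (a t), fun x => (hA.continuous_apply_const x).comp ha⟩

theorem clm_comp {B : T → Y →L[𝕜] Z} (hB : StronglyContinuousWith D B)
    (hA : StronglyContinuousWith C A) : StronglyContinuousWith (D * C) fun t => B t ∘L A t where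
  norm_le t := by
    rw [NNReal.coe_mul]
    exact (ContinuousLinearMap.opNorm_comp_le _ _).trans
      (mul_le_mul (hB.norm_le t) (hA.norm_le t) (norm_nonneg _) D.2)
  continuous_apply_const x := hB.continuous_apply (hA.continuous_apply_const x)

theorem sub (hA : StronglyContinuousWith C A) (hB : StronglyContinuousWith D B) :
    StronglyContinuousWith (C + D) fun t => A t - B t where
  norm_le t := (norm_sub_le _ _).trans (add_le_add (hA.norm_le t) (hB.norm_le t))
  continuous_apply_const x := (hA.continuous_apply_const x).sub (hB.continuous_apply_const x)

end StronglyContinuousWith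

end StronglyContinuous

/-! ### Linear Volterra equations -/

section Volterra

variable {𝕜 X : Type*} [RCLike 𝕜] [NormedAddCommGroup X] [NormedSpace ℝ X] [NormedSpace 𝕜 X]
  {A : ℝ → X →L[𝕜] X} {C : ℝ≥0}

/-- `y` solves the Volterra equation `y(t) = f + ∫₀ᵗ A(s) y(s) ds` for `t ≥ 0`; continuity is
required on all of `ℝ`, where the values at negative times are irrelevant. -/
structure IsVolterraSolution (A : ℝ → X →L[𝕜] X) (f : X) (y : ℝ → X) : Prop where
  continuous : Continuous y
  eq_add_integral : ∀ t, 0 ≤ t → y t = f + ∫ s in (0 : ℝ)..t, A s (y s)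

theorem exp_neg_mul_integral_exp_le {k : ℝ} (hk : 0 < k) (t : ℝ) :
    Real.exp (-(k * t)) * ∫ s in (0 : ℝ)..t, Real.exp (k * s) ≤ k⁻¹ := by
  have h : ∫ s in (0 : ℝ)..t, Real.exp (k * s) = k⁻¹ * (Real.exp (k * t) - 1) := by
    simp [intervalIntegral.integral_comp_mul_left _ hk.ne']
  calc Real.exp (-(k * t)) * ∫ s in (0 : ℝ)..t, Real.exp (k * s)
      = k⁻¹ * (1 - Real.exp (-(k * t))) := by
        rw [h, mul_left_comm, mul_sub, ← Real.exp_add]; simp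
    _ ≤ k⁻¹ := mul_le_of_le_one_right (by positivity) (by linarith [Real.exp_pos (-(k * t))])

/-- The Volterra integral operator conjugated by the Bielecki weight `e^{kt}`, which makes it a
contraction on bounded functions. It is extended to negative times as a constant. -/
def weightedVolterra (k : ℝ) (A : ℝ → X →L[𝕜] X) (z : ℝ → X) (t : ℝ) : X :=
  Real.exp (-(k * max t 0)) • ∫ s in (0 : ℝ)..max t 0, Real.exp (k * s) • A s (z s)

namespace StronglyContinuousWith

theorem continuous_exp_smul_apply (hA : StronglyContinuousWith C A) (k : ℝ) {z : ℝ → X}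
    (hz : Continuous z) : Continuous fun s => Real.exp (k * s) • A s (z s) :=
  Continuous.smul (by fun_prop) (hA.continuous_apply hz)

theorem continuous_weightedVolterra (hA : StronglyContinuousWith C A) (k : ℝ) {z : ℝ → X}
    (hz : Continuous z) : Continuous (weightedVolterra k A z) := by
  have hmax : Continuous fun t : ℝ => max t 0 := by fun_prop
  exact Continuous.smul (by fun_prop) ((intervalIntegral.continuous_primitive
    (fun a b => (hA.continuous_exp_smul_apply k hz).intervalIntegrable a b) 0).comp hmax)

theorem weightedVolterra_sub (hA : StronglyContinuousWith C A) (k : ℝ) {z w : ℝ → X}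
    (hz : Continuous z) (hw : Continuous w) :
    weightedVolterra k A (z - w) = weightedVolterra k A z - weightedVolterra k A w := by
  ext t
  simp only [weightedVolterra, Pi.sub_apply, map_sub, smul_sub]
  rw [intervalIntegral.integral_sub
    ((hA.continuous_exp_smul_apply k hz).intervalIntegrable _ _)
    ((hA.continuous_exp_smul_apply k hw).intervalIntegrable _ _), smul_sub]

theorem norm_weightedVolterra_le (hA : StronglyContinuousWith C A) {k : ℝ} (hk : 0 < k)
    {z : ℝ → X} {K : ℝ} (hz : ∀ t, ‖z t‖ ≤ K) (t : ℝ) :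
    ‖weightedVolterra k A z t‖ ≤ C / k * K := by
  have hK : 0 ≤ K := (norm_nonneg _).trans (hz 0)
  have hint : ‖∫ s in (0 : ℝ)..max t 0, Real.exp (k * s) • A s (z s)‖
      ≤ (∫ s in (0 : ℝ)..max t 0, Real.exp (k * s)) * (C * K) := by
    rw [← intervalIntegral.integral_mul_const]
    refine intervalIntegral.norm_integral_le_of_norm_le (le_max_right _ _)
      (ae_of_all _ fun s _ => ?_) (Continuous.intervalIntegrable (by fun_prop) _ _)
    rw [norm_smul, Real.norm_of_nonneg (Real.exp_pos _).le]
    gcongr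
    exact (hA.norm_apply_le s _).trans (by gcongr; exact hz s)
  rw [weightedVolterra, norm_smul, Real.norm_of_nonneg (Real.exp_pos _).le]
  calc _ ≤ Real.exp (-(k * max t 0)) *
        ((∫ s in (0 : ℝ)..max t 0, Real.exp (k * s)) * (C * K)) := by gcongr
    _ ≤ k⁻¹ * (C * K) := by
        rw [← mul_assoc]
        gcongr
        exact exp_neg_mul_integral_exp_le hk _
    _ = C / k * K := by ring

theorem exists_weightedVolterra_fixedPoint [CompleteSpace X] (hA : StronglyContinuousWith C A)
    {k : ℝ≥0} (hk : C < k) (g : BoundedContinuousFunction ℝ X) :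
    ∃ z : ℝ → X, Continuous z ∧ ∀ t, z t = g t + weightedVolterra k A z t := by
  have hk₀ : (0 : ℝ) < k := NNReal.coe_pos.2 hk.pos
  let Φ : BoundedContinuousFunction ℝ X → BoundedContinuousFunction ℝ X := fun z =>
    g + BoundedContinuousFunction.ofNormedAddCommGroup (weightedVolterra k A z)
      (hA.continuous_weightedVolterra k z.continuous) (C / k * ‖z‖)
      (hA.norm_weightedVolterra_le hk₀ z.norm_coe_le_norm)
  have hΦ : ContractingWith (C / k) Φ := by
    refine ⟨(div_lt_one (NNReal.coe_pos.1 hk₀)).2 hk, LipschitzWith.of_dist_le_mul fun z w => ?_⟩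
    rw [BoundedContinuousFunction.dist_le (by positivity)]
    intro t
    have hsub := congrFun (hA.weightedVolterra_sub k z.continuous w.continuous) t
    calc dist (Φ z t) (Φ w t) = ‖weightedVolterra k A (z - w) t‖ := by
          rw [hsub, dist_eq_norm]; simp [Φ]
      _ ≤ C / k * dist z w := by
          rw [dist_eq_norm]
          exact hA.norm_weightedVolterra_le hk₀ (z - w).norm_coe_le_norm t
  obtain ⟨z, hz⟩ : ∃ z, Φ z = z := ⟨_, hΦ.fixedPoint_isFixedPt⟩
  exact ⟨z, z.continuous, fun t => (congrArg (fun w => w t) hz).symm⟩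

theorem exists_isVolterraSolution [CompleteSpace X] (hA : StronglyContinuousWith C A) (f : X) :
    ∃ y, IsVolterraSolution A f y := by
  obtain ⟨k, hk⟩ := exists_gt C
  let g : BoundedContinuousFunction ℝ X := .ofNormedAddCommGroup
    (fun t => Real.exp (-(k * max t 0)) • f) (by fun_prop) ‖f‖ fun t => by
      rw [norm_smul, Real.norm_of_nonneg (Real.exp_pos _).le]
      refine mul_le_of_le_one_left (norm_nonneg _) (Real.exp_le_one_iff.2 (neg_nonpos.2 ?_))
      exact mul_nonneg k.2 (le_max_right _ _)
  obtain ⟨z, hz, hzt⟩ := hA.exists_weightedVolterra_fixedPoint hk g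
  refine ⟨fun t => Real.exp (k * t) • z t, Continuous.smul (by fun_prop) hz, fun t ht => ?_⟩
  have hA_smul : ∀ s, A s (Real.exp (k * s) • z s) = Real.exp (k * s) • A s (z s) := fun s =>
    map_real_smul (A s) (A s).continuous _ _
  simp only [hA_smul]
  conv_lhs => rw [hzt t]
  simp only [g, BoundedContinuousFunction.coe_ofNormedAddCommGroup, weightedVolterra,
    max_eq_left ht, smul_add, smul_smul, ← Real.exp_add, add_neg_cancel, Real.exp_zero, one_smul]

theorem hasDerivAt_integral_apply [CompleteSpace X] (hA : StronglyContinuousWith C A) {w : ℝ → X}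
    (hw : Continuous w) (t : ℝ) :
    HasDerivAt (fun t => ∫ s in (0 : ℝ)..t, A s (w s)) (A t (w t)) t :=
  ((hA.continuous_apply hw).integral_hasStrictDerivAt 0 t).hasDerivAt

theorem norm_le_mul_exp_of_eq_add_integral [CompleteSpace X] (hA : StronglyContinuousWith C A)
    {w r : ℝ → X} (hw : Continuous w) {δ τ : ℝ} (hr : ∀ t ∈ Icc 0 τ, ‖r t‖ ≤ δ)
    (heq : ∀ t ∈ Icc 0 τ, w t = r t + ∫ s in (0 : ℝ)..t, A s (w s)) :
    ∀ t ∈ Icc 0 τ, ‖w t‖ ≤ δ * Real.exp (C * t) := by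
  have hderiv := hA.hasDerivAt_integral_apply hw
  have hw_le : ∀ t ∈ Icc 0 τ, ‖w t‖ ≤ δ + ‖∫ s in (0 : ℝ)..t, A s (w s)‖ := fun t ht => by
    conv_lhs => rw [heq t ht]
    exact norm_add_le_of_le (hr t ht) le_rfl
  have hgronwall := norm_le_gronwallBound_of_norm_deriv_right_le (a := 0) (δ := 0) (K := C)
    (ε := C * δ) (fun t _ => (hderiv t).continuousAt.continuousWithinAt)
    (fun t _ => (hderiv t).hasDerivWithinAt) (by simp) fun t ht =>
      calc ‖A t (w t)‖ ≤ C * (δ + ‖∫ s in (0 : ℝ)..t, A s (w s)‖) :=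
            (hA.norm_apply_le t _).trans (by gcongr; exact hw_le t (Ico_subset_Icc_self ht))
        _ = _ := by ring
  intro t ht
  have hbound : gronwallBound 0 C (C * δ) (t - 0) = δ * (Real.exp (C * t) - 1) := by
    rcases eq_or_ne C 0 with rfl | hC
    · simp [gronwallBound_K0]
    · simp [gronwallBound_of_K_ne_0 (NNReal.coe_ne_zero.2 hC), hC]
  linarith [hw_le t ht, (hgronwall t ht).trans_eq hbound]

end StronglyContinuousWith

theorem tendstoUniformlyOn_of_equicontinuousOn {ι α β : Type*} [TopologicalSpace α]
    [UniformSpace β] {l : Filter ι} {F : ι → α → β} {f : α → β} {s : Set α} (hs : IsCompact s)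
    (hF : EquicontinuousOn F s) (hlim : ∀ t ∈ s, Tendsto (F · t) l (𝓝 (f t))) :
    TendstoUniformlyOn F f l s := by
  have h := (EquicontinuousOn.tendsto_uniformOnFun_iff_pi' (𝔖 := {s}) (by simpa) (by simpa) l f).2
    (tendsto_pi_nhds.2 fun t => hlim t (by simpa using t.2))
  exact UniformOnFun.tendsto_iff_tendstoUniformlyOn.1 h s rfl

theorem equicontinuousOn_integral {ι E : Type*} [NormedAddCommGroup E] [NormedSpace ℝ E]
    {r : ι → ℝ → E} (hr : ∀ i, Continuous (r i)) {K : ℝ≥0} {τ : ℝ}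
    (hK : ∀ i, ∀ s ∈ Icc 0 τ, ‖r i s‖ ≤ K) :
    EquicontinuousOn (fun i t => ∫ s in (0 : ℝ)..t, r i s) (Icc 0 τ) := by
  refine (LipschitzOnWith.uniformEquicontinuousOn _ K fun i =>
    LipschitzOnWith.of_dist_le_mul fun t ht s hs => ?_).equicontinuousOn
  rw [dist_eq_norm, intervalIntegral.integral_interval_sub_left ((hr i).intervalIntegrable _ _)
    ((hr i).intervalIntegrable _ _), Real.dist_eq]
  exact intervalIntegral.norm_integral_le_of_norm_le_const fun q hq =>
    hK i q (uIcc_subset_Icc hs ht (uIoc_subset_uIcc hq))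

namespace IsVolterraSolution

variable {f g : X} {y z : ℝ → X} {B : ℝ → X →L[𝕜] X} {D : ℝ≥0}

theorem norm_sub_le [CompleteSpace X] (hA : StronglyContinuousWith C A)
    (hB : StronglyContinuousWith D B) (hy : IsVolterraSolution A f y)
    (hz : IsVolterraSolution B g z) {δ τ : ℝ}
    (hδ : ∀ t ∈ Icc 0 τ, ‖(g - f) + ∫ s in (0 : ℝ)..t, (B s - A s) (y s)‖ ≤ δ) :
    ∀ t ∈ Icc 0 τ, ‖z t - y t‖ ≤ δ * Real.exp (D * t) := by
  have hint := fun (t : ℝ) {q : ℝ → X} (hq : Continuous q) => hq.intervalIntegrable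
    (μ := volume) 0 t
  refine hB.norm_le_mul_exp_of_eq_add_integral (hz.continuous.sub hy.continuous) hδ
    fun t ht => ?_
  rw [Pi.sub_apply, hz.eq_add_integral t ht.1, hy.eq_add_integral t ht.1, add_assoc,
    ← intervalIntegral.integral_add (hint t ((hB.sub hA).continuous_apply hy.continuous))
      (hint t (hB.continuous_apply (hz.continuous.sub hy.continuous))),
    add_sub_add_comm, ← intervalIntegral.integral_sub (hint t (hB.continuous_apply hz.continuous))
      (hint t (hA.continuous_apply hy.continuous))]
  congr 1
  refine intervalIntegral.integral_congr fun s _ => ?_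
  simp

theorem eqOn [CompleteSpace X] (hA : StronglyContinuousWith C A) (hy : IsVolterraSolution A f y)
    (hz : IsVolterraSolution A f z) : EqOn z y (Ici 0) := fun t ht =>
  sub_eq_zero.1 (norm_le_zero_iff.1
    (by simpa using norm_sub_le hA hA hy hz (δ := 0) (by simp) t (right_mem_Icc.2 ht)))

theorem tendstoUniformlyOn [CompleteSpace X] {ι : Type*} {l : Filter ι} {As : ι → ℝ → X →L[𝕜] X}
    (hAs : ∀ i, StronglyContinuousWith D (As i)) (hA : StronglyContinuousWith C A)
    {fs : ι → X} (hf : Tendsto fs l (𝓝 f))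
    {ys : ι → ℝ → X} (hys : ∀ᶠ i in l, IsVolterraSolution (As i) (fs i) (ys i))
    (hy : IsVolterraSolution A f y)
    (havg : ∀ t, 0 ≤ t → Tendsto (fun i => ∫ s in (0 : ℝ)..t, (As i s - A s) (y s)) l (𝓝 0))
    (τ : ℝ) : TendstoUniformlyOn ys y l (Icc 0 τ) := by
  have hsub := fun i => (hAs i).sub hA
  obtain ⟨M, hM⟩ := isCompact_Icc.exists_bound_of_continuousOn (s := Icc 0 τ)
    hy.continuous.continuousOn
  have hsource : TendstoUniformlyOn
      (fun i t => (fs i - f) + ∫ s in (0 : ℝ)..t, (As i s - A s) (y s)) 0 l (Icc 0 τ) := by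
    have hconst : TendstoUniformlyOn (fun i _ => fs i - f) 0 l (Icc 0 τ) :=
      (tendsto_sub_nhds_zero_iff.2 hf).tendstoUniformlyOn_const _
    have hint := tendstoUniformlyOn_of_equicontinuousOn isCompact_Icc
      (equicontinuousOn_integral (K := (D + C) * M.toNNReal)
        (fun i => (hsub i).continuous_apply hy.continuous) fun i s hs =>
          ((hsub i).norm_apply_le s _).trans (by
            push_cast
            gcongr
            exact (hM s hs).trans (Real.le_coe_toNNReal M)))
      (f := 0) fun t ht => havg t ht.1
    have hsum := hconst.add hint
    rwa [add_zero] at hsum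
  rw [Metric.tendstoUniformlyOn_iff] at hsource ⊢
  intro η hη
  filter_upwards [hys, hsource (η / 2 * Real.exp (-(D * τ))) (by positivity)] with i hi hri t ht
  calc dist (y t) (ys i t) = ‖ys i t - y t‖ := dist_eq_norm' _ _
    _ ≤ η / 2 * Real.exp (-(D * τ)) * Real.exp (D * t) :=
        norm_sub_le hA (hAs i) hy hi (fun t ht => by simpa using (hri t ht).le) t ht
    _ ≤ η / 2 * Real.exp (-(D * τ)) * Real.exp (D * τ) := by gcongr; exact ht.2
    _ = η / 2 := by rw [mul_assoc, ← Real.exp_add]; simp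
    _ < η := half_lt_self hη

end IsVolterraSolution

end Volterra

/-! ### Averaging -/

section Averaging

/-- The operators `S i s` average to zero along `l`: their integrals along any fixed continuous
curve tend to zero. -/
def AveragesToZero {ι 𝕜 X Y : Type*} [NormedField 𝕜] [NormedAddCommGroup X] [NormedSpace 𝕜 X]
    [NormedAddCommGroup Y] [NormedSpace ℝ Y] [NormedSpace 𝕜 Y] (l : Filter ι)
    (S : ι → ℝ → X →L[𝕜] Y) : Prop :=
  ∀ q : ℝ → X, Continuous q → ∀ t, 0 ≤ t →
    Tendsto (fun i => ∫ s in (0 : ℝ)..t, S i s (q s)) l (𝓝 0)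

namespace AveragesToZero

variable {ι 𝕜 X Y Z : Type*} [NontriviallyNormedField 𝕜] [NormedAddCommGroup X] [NormedSpace 𝕜 X]
  [NormedAddCommGroup Y] [NormedSpace ℝ Y] [NormedSpace 𝕜 Y] [NormedAddCommGroup Z]
  [NormedSpace 𝕜 Z] {l : Filter ι} {S : ι → ℝ → X →L[𝕜] Y} {C : ℝ≥0}

theorem comp_right (hS : AveragesToZero l S) (T : Z →L[𝕜] X) :
    AveragesToZero l fun i s => S i s ∘L T :=
  fun _ hq t ht => hS _ (T.continuous.comp hq) t ht

theorem comp_tendsto {κ : Type*} {k : Filter κ} {a : κ → ι} (hS : AveragesToZero l S)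
    (ha : Tendsto a k l) : AveragesToZero k fun j => S (a j) :=
  fun q hq t ht => (hS q hq t ht).comp ha

theorem sum {κ : Type*} {u : Finset κ} {S : κ → ι → ℝ → X →L[𝕜] Y} {C : κ → ℝ≥0}
    (hSC : ∀ m i, StronglyContinuousWith (C m) (S m i)) (hS : ∀ m ∈ u, AveragesToZero l (S m)) :
    AveragesToZero l fun i s => ∑ m ∈ u, S m i s := fun q hq t ht => by
  have hlim := tendsto_finsetSum u fun m hm => hS m hm q hq t ht
  rw [Finset.sum_const_zero] at hlim
  refine hlim.congr fun i => ?_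
  simp only [sum_apply]
  exact (intervalIntegral.integral_finsetSum fun m _ =>
    ((hSC m i).continuous_apply hq).intervalIntegrable _ _).symm

theorem of_approximation {κ : Type*} {k : Filter κ} [k.NeBot] [k.IsCountablyGenerated]
    {P : κ → X →L[𝕜] X} {K : ℝ} (hP : ∀ N, ‖P N‖ ≤ K) (hlim : ∀ x, Tendsto (P · x) k (𝓝 x))
    (hSC : ∀ i, StronglyContinuousWith C (S i))
    (hSP : ∀ N, AveragesToZero l fun i s => S i s ∘L P N) : AveragesToZero l S := by
  intro q hq t ht
  have hPq : ∀ N, Continuous fun s => P N (q s) := fun N => (P N).continuous.comp hq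
  have hdefect : Tendsto (fun N => C * ∫ s in (0 : ℝ)..t, ‖q s - P N (q s)‖) k (𝓝 0) := by
    have h := intervalIntegral.tendsto_integral_filter_of_dominated_convergence (l := k)
      (μ := volume) (a := 0) (b := t) (F := fun N s => ‖q s - P N (q s)‖) (f := fun _ => 0)
      (fun s => ‖q s‖ + K * ‖q s‖)
      (.of_forall fun N => (hq.sub (hPq N)).norm.aestronglyMeasurable)
      (.of_forall fun N => ae_of_all _ fun s _ => by
        rw [norm_norm]
        exact norm_sub_le_of_le le_rfl ((P N).le_of_opNorm_le (hP N) _))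
      ((hq.norm.add (hq.norm.const_mul K)).intervalIntegrable _ _)
      (ae_of_all _ fun s _ => by simpa using ((hlim (q s)).const_sub (q s)).norm)
    simpa using h.const_mul (C : ℝ)
  have hunif : TendstoUniformly (fun N i => ∫ s in (0 : ℝ)..t, S i s (P N (q s)))
      (fun i => ∫ s in (0 : ℝ)..t, S i s (q s)) k := by
    rw [Metric.tendstoUniformly_iff]
    intro η hη
    filter_upwards [hdefect.eventually_lt_const hη] with N hN i
    refine lt_of_le_of_lt ?_ hN
    rw [dist_eq_norm, ← intervalIntegral.integral_const_mul, ← intervalIntegral.integral_sub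
      (((hSC i).continuous_apply hq).intervalIntegrable _ _)
      (((hSC i).continuous_apply (hPq N)).intervalIntegrable _ _)]
    refine intervalIntegral.norm_integral_le_of_norm_le ht (ae_of_all _ fun s _ => ?_)
      (((hq.sub (hPq N)).norm.const_mul _).intervalIntegrable _ _)
    rw [← map_sub]
    exact (hSC i).norm_apply_le _ _
  exact (hunif.tendstoUniformlyOnFilter.mono_right le_top).tendsto_of_eventually_tendsto
    (.of_forall fun N => hSP N q hq t ht) tendsto_const_nhds

theorem of_single {κ : Type*} [Countable κ] [DecidableEq κ] {G : κ → Type*}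
    [∀ n, NormedAddCommGroup (G n)] [∀ n, NormedSpace 𝕜 (G n)] {p : ℝ≥0∞} [Fact (1 ≤ p)]
    (hp : p ≠ ⊤) {S : ι → ℝ → lp G p →L[𝕜] Y} (hSC : ∀ i, StronglyContinuousWith C (S i))
    (hS : ∀ m, AveragesToZero l fun i s => S i s ∘L lp.singleContinuousLinearMap 𝕜 G p m) :
    AveragesToZero l S := by
  let P : κ → lp G p →L[𝕜] lp G p := fun m =>
    lp.singleContinuousLinearMap 𝕜 G p m ∘L lp.evalCLM 𝕜 G p m
  have hP : ∀ (u : Finset κ) x, (∑ m ∈ u, P m) x = ∑ m ∈ u, lp.single p m (x m) := fun u x => by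
    simp [P]; rfl
  refine of_approximation (k := atTop) (P := fun u : Finset κ => ∑ m ∈ u, P m) (K := 1)
    (fun u => ContinuousLinearMap.opNorm_le_bound _ zero_le_one fun x => ?_) (fun x => ?_) hSC
    fun u => ?_
  · rw [one_mul, hP]
    refine lp.norm_mono (zero_lt_one.trans_le Fact.out).ne' fun m => ?_
    simp only [lp.coeFn_sum, lp.coeFn_single, Finset.sum_apply, Finset.sum_pi_single]
    split_ifs <;> simp
  · simp only [hP]
    exact lp.hasSum_single hp x
  · simp only [ContinuousLinearMap.comp_finsetSum]
    exact sum (fun m i => (hSC i).clm_comp (.const (P m))) fun m _ =>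
      (hS m).comp_right (lp.evalCLM 𝕜 G p m)

end AveragesToZero

theorem tendsto_integral_exp_smul_atTop {X : Type*} [NormedAddCommGroup X] [NormedSpace ℂ X]
    (g : ℝ → X) {ω : ℝ} (hω : ω ≠ 0) {t : ℝ} (ht : 0 ≤ t) :
    Tendsto (fun r : ℝ => ∫ s in (0 : ℝ)..t,
      (Circle.exp (ω * (r * s)) : ℂ) • g s) atTop (𝓝 0) := by
  have hfreq : Tendsto (fun r : ℝ => -(ω / (2 * Real.pi)) * r) atTop (cocompact ℝ) := by
    rw [← Metric.cobounded_eq_cocompact, ← tendsto_norm_atTop_iff_cobounded]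
    simp only [norm_mul]
    exact tendsto_norm_atTop_atTop.const_mul_atTop (norm_pos_iff.2 (by simp [hω, Real.pi_ne_zero]))
  refine ((Real.tendsto_integral_exp_smul_cocompact ((Ioc 0 t).indicator g)).comp hfreq).congr
    fun r => ?_
  rw [Function.comp_apply, intervalIntegral.integral_of_le ht,
    ← integral_indicator measurableSet_Ioc]
  refine integral_congr_ae (ae_of_all _ fun s => ?_)
  by_cases hs : s ∈ Ioc 0 t
  · simp only [indicator_of_mem hs, Circle.smul_def, Real.fourierChar_apply']
    congr 3
    field_simp
  · simp [indicator_of_notMem hs]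

theorem tendsto_inv_sq_nhdsGT_zero : Tendsto (fun ε : ℝ => (ε ^ 2)⁻¹) (𝓝[>] 0) atTop := by
  simpa [Function.comp_def] using
    (tendsto_pow_atTop (α := ℝ) two_ne_zero).comp tendsto_inv_nhdsGT_zero

end Averaging

/-! ### Contraction groups and mild solutions -/

section ContractionGroup

variable {𝕜 X : Type*} [NontriviallyNormedField 𝕜] [NormedAddCommGroup X] [NormedSpace 𝕜 X]

/-- A strongly continuous one-parameter group of contractions (hence of isometries). -/
structure IsContractionGroup (U : ℝ → X →L[𝕜] X) : Prop extends StronglyContinuousWith 1 U where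
  map_zero : U 0 = .id 𝕜 X
  map_add : ∀ s t, U (s + t) = U s ∘L U t

namespace IsContractionGroup

variable {U : ℝ → X →L[𝕜] X}

theorem apply_neg_apply (hU : IsContractionGroup U) (t : ℝ) (x : X) : U t (U (-t) x) = x := by
  rw [← ContinuousLinearMap.comp_apply, ← hU.map_add, add_neg_cancel, hU.map_zero]
  rfl

theorem neg_apply_apply (hU : IsContractionGroup U) (t : ℝ) (x : X) : U (-t) (U t x) = x := by
  simpa using hU.apply_neg_apply (-t) x

theorem norm_apply_le (hU : IsContractionGroup U) (t : ℝ) (x : X) : ‖U t x‖ ≤ ‖x‖ := by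
  simpa using hU.toStronglyContinuousWith.norm_apply_le t x

theorem conj_linearIsometryEquiv {Y : Type*} [NormedAddCommGroup Y] [NormedSpace 𝕜 Y]
    (hU : IsContractionGroup U) (e : Y ≃ₗᵢ[𝕜] X) : IsContractionGroup fun t =>
      (e.symm : X →L[𝕜] Y) ∘L U t ∘L (e : Y →L[𝕜] X) where
  norm_le t := ContinuousLinearMap.opNorm_le_bound _ (by simp) fun y => by
    simpa using hU.norm_apply_le t (e y)
  continuous_apply_const y := e.symm.continuous.comp (hU.continuous_apply_const (e y))
  map_zero := by ext; simp [hU.map_zero]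
  map_add s t := by ext; simp [hU.map_add]

end IsContractionGroup

/-- The coefficient `U(-s) B(s) U(s)` of the evolution equation in the interaction picture. -/
def interactionGenerator (U B : ℝ → X →L[𝕜] X) (s : ℝ) : X →L[𝕜] X :=
  U (-s) ∘L B s ∘L U s

theorem StronglyContinuousWith.interactionGenerator {U B : ℝ → X →L[𝕜] X} {C : ℝ≥0}
    (hB : StronglyContinuousWith C B) (hU : IsContractionGroup U) :
    StronglyContinuousWith C (interactionGenerator U B) := by
  have h := (hU.comp_continuous continuous_neg).clm_comp (hB.clm_comp hU.toStronglyContinuousWith)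
  rwa [one_mul, mul_one] at h

end ContractionGroup

section MildSolutions

variable {𝕜 X : Type*} [RCLike 𝕜] [NormedAddCommGroup X] [NormedSpace ℝ X] [NormedSpace 𝕜 X]

/-- `h` is a mild solution of `h' = 𝒜 h + B(t) h`, `h(0) = f`, on `[0, ∞)`, where `𝒜` is the
generator of the group `U`: it is continuous and satisfies the Duhamel formula. -/
structure IsMild (U B : ℝ → X →L[𝕜] X) (f : X) (h : ℝ → X) : Prop where
  continuousOn : ContinuousOn h (Ici 0)
  eq_add_integral : ∀ t, 0 ≤ t → h t = U t f + ∫ s in (0 : ℝ)..t, U (t - s) (B s (h s))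

variable {U B : ℝ → X →L[𝕜] X} {C : ℝ≥0} {f : X} {h : ℝ → X}

theorem integral_duhamel_eq_apply_integral [CompleteSpace X] (hU : IsContractionGroup U)
    (hB : StronglyContinuousWith C B) {y : ℝ → X} (hy : Continuous y)
    (hyh : ∀ t, 0 ≤ t → h t = U t (y t)) {t : ℝ} (ht : 0 ≤ t) :
    ∫ s in (0 : ℝ)..t, U (t - s) (B s (h s))
      = U t (∫ s in (0 : ℝ)..t, interactionGenerator U B s (y s)) := by
  rw [← (U t).intervalIntegral_comp_comm
    (((hB.interactionGenerator hU).continuous_apply hy).intervalIntegrable _ _)]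
  refine intervalIntegral.integral_congr fun s hs => ?_
  rw [uIcc_of_le ht] at hs
  simp [interactionGenerator, hyh s hs.1, sub_eq_add_neg, hU.map_add]

theorem IsVolterraSolution.isMild [CompleteSpace X] (hU : IsContractionGroup U)
    (hB : StronglyContinuousWith C B) {y : ℝ → X}
    (hy : IsVolterraSolution (interactionGenerator U B) f y) :
    IsMild U B f fun t => U t (y t) where
  continuousOn := (hU.continuous_apply hy.continuous).continuousOn
  eq_add_integral t ht := by
    rw [integral_duhamel_eq_apply_integral hU hB hy.continuous (fun _ _ => rfl) ht, ← map_add,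
      ← hy.eq_add_integral t ht]

theorem exists_isMild [CompleteSpace X] (hU : IsContractionGroup U)
    (hB : StronglyContinuousWith C B) (f : X) : ∃ h, IsMild U B f h :=
  have ⟨_, hy⟩ := (hB.interactionGenerator hU).exists_isVolterraSolution f
  ⟨_, hy.isMild hU hB⟩

namespace IsMild

theorem exists_isVolterraSolution [CompleteSpace X] (hU : IsContractionGroup U)
    (hB : StronglyContinuousWith C B) (hh : IsMild U B f h) :
    ∃ y, IsVolterraSolution (interactionGenerator U B) f y ∧ ∀ t, 0 ≤ t → h t = U t (y t) := by
  have hmax : Continuous fun t : ℝ => max t 0 := by fun_prop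
  have hy : Continuous fun t => U (-max t 0) (h (max t 0)) :=
    (hU.comp_continuous hmax.neg).continuous_apply
      (hh.continuousOn.comp_continuous hmax fun t => mem_Ici.2 (le_max_right _ _))
  have hyh : ∀ t, 0 ≤ t → h t = U t (U (-max t 0) (h (max t 0))) := fun t ht => by
    rw [max_eq_left ht, hU.apply_neg_apply]
  refine ⟨_, ⟨hy, fun t ht => ?_⟩, hyh⟩
  simp only [max_eq_left ht]
  rw [hh.eq_add_integral t ht, integral_duhamel_eq_apply_integral hU hB hy hyh ht, ← _root_.map_add,
    hU.neg_apply_apply]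

theorem eqOn [CompleteSpace X] (hU : IsContractionGroup U) (hB : StronglyContinuousWith C B)
    {h' : ℝ → X} (hh : IsMild U B f h) (hh' : IsMild U B f h') : EqOn h' h (Ici 0) := by
  obtain ⟨y, hy, hyh⟩ := hh.exists_isVolterraSolution hU hB
  obtain ⟨y', hy', hyh'⟩ := hh'.exists_isVolterraSolution hU hB
  intro t ht
  rw [hyh t ht, hyh' t ht, hy.eqOn (hB.interactionGenerator hU) hy' ht]

theorem tendstoUniformlyOn [CompleteSpace X] {ι : Type*} {l : Filter ι} {D : ℝ≥0}
    {Bs : ι → ℝ → X →L[𝕜] X} {fs : ι → X} {hs : ι → ℝ → X} (hU : IsContractionGroup U)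
    (hBs : ∀ i, StronglyContinuousWith D (Bs i)) (hB : StronglyContinuousWith C B)
    (havg : AveragesToZero l fun i s => U (-s) ∘L (Bs i s - B s)) (hf : Tendsto fs l (𝓝 f))
    (hhs : ∀ᶠ i in l, IsMild U (Bs i) (fs i) (hs i)) (hh : IsMild U B f h) (τ : ℝ) :
    TendstoUniformlyOn hs h l (Icc 0 τ) := by
  obtain ⟨y, hy, hyh⟩ := hh.exists_isVolterraSolution hU hB
  choose! ys hys hysh using fun i (hi : IsMild U (Bs i) (fs i) (hs i)) =>
    hi.exists_isVolterraSolution hU (hBs i)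
  have hlim : TendstoUniformlyOn ys y l (Icc 0 τ) :=
    hy.tendstoUniformlyOn (fun i => (hBs i).interactionGenerator hU) (hB.interactionGenerator hU)
      hf (hhs.mono hys) (fun t ht => by
        simpa [interactionGenerator] using havg _ (hU.continuous_apply hy.continuous) t ht) τ
  rw [Metric.tendstoUniformlyOn_iff] at hlim ⊢
  intro η hη
  filter_upwards [hhs, hlim η hη] with i hi hyi t ht
  refine lt_of_le_of_lt ?_ (hyi t ht)
  rw [hyh t ht.1, hysh i hi t ht.1, dist_eq_norm, dist_eq_norm, ← map_sub]
  exact hU.norm_apply_le t _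

end IsMild

end MildSolutions

/-! ### Diagonal operators and oscillating phases on `ℓᵖ` direct sums -/

section Diagonal

variable {𝕜 T κ : Type*} [NontriviallyNormedField 𝕜] [TopologicalSpace T] {G H : κ → Type*}
  [∀ n, NormedAddCommGroup (G n)] [∀ n, NormedSpace 𝕜 (G n)] [∀ n, NormedAddCommGroup (H n)]
  [∀ n, NormedSpace 𝕜 (H n)] {p : ℝ≥0∞} [Fact (1 ≤ p)]

theorem mapCLM_single [DecidableEq κ] (A : ∀ n, G n →L[𝕜] H n) {K : ℝ} (hK : 0 ≤ K)
    (hA : ∀ n, ‖A n‖ ≤ K) (m : κ) (x : G m) :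
    lp.mapCLM p A hK hA (lp.single p m x) = lp.single p m (A m x) := by
  ext n
  obtain rfl | hn := eq_or_ne n m <;> simp [*]

theorem StronglyContinuousWith.lpMap (hp : p ≠ ⊤) {C : ℝ≥0} {A : ∀ n, T → G n →L[𝕜] H n}
    (hA : ∀ n, StronglyContinuousWith C (A n)) : StronglyContinuousWith C fun t =>
      lp.mapCLM p (fun n => A n t) C.coe_nonneg fun n => (hA n).norm_le t where
  norm_le t := lp.norm_mapCLM_le p _ C.coe_nonneg _
  continuous_apply_const h := by
    classical
    have hpartial (u : Finset κ) : Continuous fun t => lp.mapCLM p (fun n => A n t) C.coe_nonneg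
        (fun n => (hA n).norm_le t) (∑ m ∈ u, lp.single p m (h m)) := by
      simp only [map_sum, mapCLM_single]
      exact continuous_finsetSum u fun m _ =>
        (lp.singleContinuousLinearMap 𝕜 H p m).continuous.comp ((hA m).continuous_apply_const _)
    refine TendstoUniformly.continuous (p := atTop) ?_ (.of_forall hpartial)
    have hdist := (tendsto_iff_dist_tendsto_zero.1 (lp.hasSum_single hp h)).const_mul (C : ℝ)
    rw [mul_zero] at hdist
    rw [Metric.tendstoUniformly_iff]
    intro η hη
    filter_upwards [hdist.eventually_lt_const hη] with u hu t
    refine lt_of_le_of_lt ?_ hu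
    rw [dist_comm, dist_eq_norm, dist_eq_norm, ← map_sub]
    exact ContinuousLinearMap.le_of_opNorm_le _ (lp.norm_mapCLM_le p _ C.coe_nonneg _) _

theorem IsContractionGroup.lpMap (hp : p ≠ ⊤) {U : ∀ n, ℝ → G n →L[𝕜] G n}
    (hU : ∀ n, IsContractionGroup (U n)) : IsContractionGroup fun t =>
      lp.mapCLM p (fun n => U n t) (NNReal.coe_nonneg 1) fun n => (hU n).norm_le t where
  toStronglyContinuousWith := .lpMap hp fun n => (hU n).toStronglyContinuousWith
  map_zero := by ext h n; simp [(hU n).map_zero]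
  map_add s t := by ext h n; simp [(hU n).map_add]

variable [DecidableEq κ]

/-- The diagonal part of an operator on an `ℓᵖ` direct sum. -/
def diagonalPart (A : lp G p →L[𝕜] lp G p) : lp G p →L[𝕜] lp G p :=
  lp.mapCLM p (fun n => lp.evalCLM 𝕜 G p n ∘L A ∘L lp.singleContinuousLinearMap 𝕜 G p n)
    (norm_nonneg A) fun n => ContinuousLinearMap.opNorm_le_bound _ (norm_nonneg A) fun x => by
      have hp : 0 < p := zero_lt_one.trans_le Fact.out
      exact ((lp.norm_apply_le_norm hp.ne' _ n).trans (A.le_opNorm _)).trans_eq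
        (congrArg _ (lp.norm_single hp n x))

theorem diagonalPart_apply (A : lp G p →L[𝕜] lp G p) (h : lp G p) (n : κ) :
    diagonalPart A h n = A (lp.single p n (h n)) n := rfl

theorem diagonalPart_single (A : lp G p →L[𝕜] lp G p) (n : κ) (x : G n) :
    diagonalPart A (lp.single p n x) = lp.single p n (A (lp.single p n x) n) :=
  mapCLM_single _ _ _ n x

end Diagonal

section Phases

theorem isContractionGroup_circleExp_smul (X : Type*) [NormedAddCommGroup X] [NormedSpace ℂ X]
    (e : ℝ) : IsContractionGroup fun r : ℝ =>
      (Circle.exp (e * r) : ℂ) • ContinuousLinearMap.id ℂ X where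
  norm_le r := ContinuousLinearMap.opNorm_le_bound _ zero_le_one fun x => by
    rw [smul_apply, norm_smul, Circle.norm_coe]
    rfl
  continuous_apply_const x := by
    simp only [smul_apply]
    fun_prop
  map_zero := by simp
  map_add s t := by
    ext x
    simp only [mul_add, Circle.exp_add, Circle.coe_mul, mul_smul, smul_apply,
      ContinuousLinearMap.comp_apply, ContinuousLinearMap.id_apply]

variable {κ : Type*} {G : κ → Type*} [∀ n, NormedAddCommGroup (G n)] [∀ n, NormedSpace ℂ (G n)]
  {p : ℝ≥0∞} [Fact (1 ≤ p)] {C : ℝ≥0} {E : κ → ℝ}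

/-- The unitary group `(x_n) ↦ (exp (i E_n r) x_n)` of phases on an `ℓᵖ` direct sum. -/
def phaseGroup (E : κ → ℝ) (r : ℝ) : lp G p →L[ℂ] lp G p :=
  lp.mapCLM p (fun n => (Circle.exp (E n * r) : ℂ) • ContinuousLinearMap.id ℂ (G n))
    (NNReal.coe_nonneg 1) fun n => (isContractionGroup_circleExp_smul (G n) (E n)).norm_le r

theorem phaseGroup_apply (E : κ → ℝ) (r : ℝ) (x : lp G p) (n : κ) :
    phaseGroup E r x n = (Circle.exp (E n * r) : ℂ) • x n := rfl

theorem isContractionGroup_phaseGroup (hp : p ≠ ⊤) (E : κ → ℝ) :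
    IsContractionGroup (phaseGroup (G := G) (p := p) E) :=
  .lpMap hp fun n => isContractionGroup_circleExp_smul (G n) (E n)

/-- The conjugate of `A` by the phases at `r`; its matrix elements are those of `A`, multiplied by
`exp (i (E_n - E_m) r)`. -/
def phaseConj (E : κ → ℝ) (A : lp G p →L[ℂ] lp G p) (r : ℝ) : lp G p →L[ℂ] lp G p :=
  phaseGroup E r ∘L A ∘L phaseGroup E (-r)

theorem stronglyContinuousWith_phaseConj (hp : p ≠ ⊤) (E : κ → ℝ) (A : lp G p →L[ℂ] lp G p) :
    StronglyContinuousWith ‖A‖₊ (phaseConj E A) := by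
  have hE := (isContractionGroup_phaseGroup (G := G) hp E).toStronglyContinuousWith
  have h := hE.clm_comp ((StronglyContinuousWith.const A).clm_comp
    (hE.comp_continuous continuous_neg))
  rwa [one_mul, mul_one] at h

theorem circleExp_smul_phaseGroup (e : ℝ) (E : κ → ℝ) (r : ℝ) (x : lp G p) :
    (Circle.exp (e * -r) : ℂ) • phaseGroup E r x = phaseGroup (fun n => E n - e) r x := by
  ext n
  rw [lp.coeFn_smul, Pi.smul_apply, phaseGroup_apply, phaseGroup_apply, smul_smul, ← Circle.coe_mul,
    ← Circle.exp_add]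
  ring_nf

variable [DecidableEq κ]

theorem phaseGroup_single (E : κ → ℝ) (r : ℝ) (m : κ) (x : G m) :
    phaseGroup E r (lp.single p m x) = (Circle.exp (E m * r) : ℂ) • lp.single p m x :=
  (mapCLM_single _ (NNReal.coe_nonneg 1) _ m x).trans (lp.single_smul p m _ x)

theorem phaseConj_sub_diagonalPart_comp_single (E : κ → ℝ) (A : lp G p →L[ℂ] lp G p) (r : ℝ)
    (m : κ) :
    (phaseConj E A r - diagonalPart A) ∘L lp.singleContinuousLinearMap ℂ G p m
      = (phaseGroup (fun n => E n - E m) r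
          - lp.singleContinuousLinearMap ℂ G p m ∘L lp.evalCLM ℂ G p m)
        ∘L A ∘L lp.singleContinuousLinearMap ℂ G p m := by
  ext1 x
  simp only [ContinuousLinearMap.comp_apply, sub_apply, phaseConj,
    lp.singleContinuousLinearMap_apply, phaseGroup_single, diagonalPart_single, map_smul,
    circleExp_smul_phaseGroup]
  rfl

variable [Countable κ] {Y : Type*} [NormedAddCommGroup Y] [NormedSpace ℂ Y]
  {U : ℝ → lp G p →L[ℂ] Y}

theorem averagesToZero_phaseGroup_sub_single (hp : p ≠ ⊤) (hU : StronglyContinuousWith C U)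
    {m : κ} (hm : E m = 0) (hE : ∀ n ≠ m, E n ≠ 0) :
    AveragesToZero atTop fun r s => U s ∘L (phaseGroup E (r * s)
      - lp.singleContinuousLinearMap ℂ G p m ∘L lp.evalCLM ℂ G p m) := by
  refine .of_single hp (fun r => hU.clm_comp
    (((isContractionGroup_phaseGroup hp E).comp_continuous (by fun_prop)).sub (.const _)))
    fun n q _ t ht => ?_
  have hq : ∀ r s, (phaseGroup E (r * s) - lp.singleContinuousLinearMap ℂ G p m
      ∘L lp.evalCLM ℂ G p m : lp G p →L[ℂ] lp G p) (lp.single p n (q s))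
      = if n = m then 0 else (Circle.exp (E n * (r * s)) : ℂ) • lp.single p n (q s) := by
    intro r s
    rw [sub_apply, phaseGroup_single]
    change _ - lp.single p m (lp.single p n (q s) m) = _
    split_ifs with hnm
    · subst hnm
      simp [hm]
    · rw [lp.single_apply_ne _ _ _ (Ne.symm hnm), lp.single_zero, sub_zero]
  simp only [ContinuousLinearMap.comp_apply, lp.singleContinuousLinearMap_apply, hq]
  split_ifs with hnm
  · simp
  · simpa only [map_smul] using tendsto_integral_exp_smul_atTop _ (hE n hnm) ht

theorem averagesToZero_phaseConj_sub_diagonalPart (hp : p ≠ ⊤) (hU : StronglyContinuousWith C U)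
    (hE : Function.Injective E) (A : lp G p →L[ℂ] lp G p) :
    AveragesToZero atTop fun r s => U s ∘L (phaseConj E A (r * s) - diagonalPart A) := by
  refine .of_single hp (fun r => hU.clm_comp
    (((stronglyContinuousWith_phaseConj hp E A).comp_continuous (by fun_prop)).sub (.const _)))
    fun m => ?_
  simp only [ContinuousLinearMap.comp_assoc, phaseConj_sub_diagonalPart_comp_single]
  simp only [← ContinuousLinearMap.comp_assoc]
  exact ((averagesToZero_phaseGroup_sub_single hp hU (sub_self (E m)) fun n hn =>
    sub_ne_zero.2 (hE.ne hn)).comp_right A).comp_right _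

end Phases

/-! ### Multiplication operators and the free group -/

section Multiplication

variable {α : Type*} [MeasurableSpace α] {ν : Measure α} {p : ℝ≥0∞}

theorem tendsto_eLpNorm_zero_of_dominated {ι F : Type*} [NormedAddCommGroup F] {l : Filter ι}
    [l.IsCountablyGenerated] (hp₀ : p ≠ 0) (hp : p ≠ ⊤) {f : ι → α → F} {g : α → ℝ}
    (hf : ∀ i, AEStronglyMeasurable (f i) ν) (hg : MemLp g p ν)
    (hfg : ∀ i, ∀ᵐ x ∂ν, ‖f i x‖ ≤ g x) (hlim : ∀ᵐ x ∂ν, Tendsto (f · x) l (𝓝 0)) :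
    Tendsto (fun i => eLpNorm (f i) p ν) l (𝓝 0) := by
  have hp_pos : 0 < p.toReal := ENNReal.toReal_pos hp₀ hp
  have hint : Tendsto (fun i => ∫⁻ x, ‖f i x‖ₑ ^ p.toReal ∂ν) l (𝓝 0) := by
    simpa [hp_pos] using tendsto_lintegral_filter_of_dominated_convergence'
      (fun x => ‖g x‖ₑ ^ p.toReal)
      (.of_forall fun i => (hf i).enorm.pow_const _)
      (.of_forall fun i => (hfg i).mono fun x hx => by
        gcongr
        exact enorm_le_iff_norm_le.2 (hx.trans (le_abs_self _)))
      (lintegral_rpow_enorm_lt_top_of_eLpNorm_lt_top hp₀ hp hg.2).ne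
      (hlim.mono fun x hx => (hx.enorm.ennrpow_const p.toReal))
  simpa [eLpNorm_eq_lintegral_rpow_enorm_toReal hp₀ hp, hp_pos] using
    hint.ennrpow_const p.toReal⁻¹

variable {𝕜 : Type*} [RCLike 𝕜] [Fact (1 ≤ p)] {a b : α → 𝕜}

/-- Multiplication by an essentially bounded function, as an operator on `Lᵖ`. -/
def mulOperator (p : ℝ≥0∞) [Fact (1 ≤ p)] (ha : MemLp a ⊤ ν) : Lp 𝕜 p ν →L[𝕜] Lp 𝕜 p ν :=
  (ContinuousLinearMap.mul 𝕜 𝕜).holderL ν ⊤ p p (ha.toLp a)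

theorem coeFn_mulOperator (ha : MemLp a ⊤ ν) (f : Lp 𝕜 p ν) :
    mulOperator p ha f =ᵐ[ν] fun x => a x * f x := by
  filter_upwards [(ContinuousLinearMap.mul 𝕜 𝕜).coeFn_holder (r := p) (ha.toLp a) f,
    ha.coeFn_toLp] with x hx hax
  exact hx.trans (by simp [hax])

theorem norm_mulOperator_le (ha : MemLp a ⊤ ν) {C : ℝ≥0} (hC : ∀ᵐ x ∂ν, ‖a x‖ ≤ C) :
    ‖mulOperator p ha‖ ≤ C :=
  ContinuousLinearMap.opNorm_le_bound _ C.coe_nonneg fun f => by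
    refine Lp.norm_le_mul_norm_of_ae_le_mul ?_
    filter_upwards [coeFn_mulOperator ha f, hC] with x hx hax
    rw [hx, norm_mul]
    gcongr

theorem mulOperator_eq_id (ha : MemLp a ⊤ ν) (h : a =ᵐ[ν] 1) :
    mulOperator p ha = .id 𝕜 (Lp 𝕜 p ν) := by
  ext1 f
  refine Lp.ext ?_
  filter_upwards [coeFn_mulOperator ha f, h] with x hx hax
  simp [hx, hax]

theorem mulOperator_mul {c : α → 𝕜} (ha : MemLp a ⊤ ν) (hb : MemLp b ⊤ ν) (hc : MemLp c ⊤ ν)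
    (h : c =ᵐ[ν] a * b) : mulOperator p hc = mulOperator p ha ∘L mulOperator p hb := by
  ext1 f
  refine Lp.ext ?_
  filter_upwards [coeFn_mulOperator hc f, coeFn_mulOperator hb f,
    coeFn_mulOperator ha (mulOperator p hb f), h] with x hcx hbx hax hx
  rw [hcx, ContinuousLinearMap.comp_apply, hax, hbx, hx, Pi.mul_apply, mul_assoc]

theorem stronglyContinuousWith_mulOperator (hp : p ≠ ⊤) {T : Type*} [TopologicalSpace T]
    [FirstCountableTopology T] {a : T → α → 𝕜} (ha : ∀ t, MemLp (a t) ⊤ ν) {C : ℝ≥0}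
    (hC : ∀ t, ∀ᵐ x ∂ν, ‖a t x‖ ≤ C) (hcont : ∀ᵐ x ∂ν, Continuous fun t => a t x) :
    StronglyContinuousWith C fun t => mulOperator p (ha t) where
  norm_le t := norm_mulOperator_le (ha t) (hC t)
  continuous_apply_const f := continuous_iff_continuousAt.2 fun t₀ => by
    rw [ContinuousAt, Lp.tendsto_Lp_iff_tendsto_eLpNorm']
    have hsub (t : T) : ⇑(mulOperator p (ha t) f) - ⇑(mulOperator p (ha t₀) f)
        =ᵐ[ν] fun x => (a t x - a t₀ x) * f x := by
      filter_upwards [coeFn_mulOperator (ha t) f, coeFn_mulOperator (ha t₀) f] with x hx hx₀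
      rw [Pi.sub_apply, hx, hx₀, sub_mul]
    rw [tendsto_congr fun t => eLpNorm_congr_ae (hsub t)]
    refine tendsto_eLpNorm_zero_of_dominated (g := fun x => (C + C) * ‖f x‖)
      (zero_lt_one.trans_le Fact.out).ne' hp
      (fun t => ((ha t).1.sub (ha t₀).1).mul (Lp.aestronglyMeasurable f))
      ((Lp.memLp f).norm.const_mul _) (fun t => ?_) ?_
    · filter_upwards [hC t, hC t₀] with x hx hx₀
      rw [norm_mul]
      gcongr
      exact norm_sub_le_of_le hx hx₀
    · filter_upwards [hcont] with x hx
      have h := ((hx.tendsto t₀).sub_const (a t₀ x)).mul_const (f x)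
      rwa [sub_self, zero_mul] at h

theorem memLp_circleExp {q : α → ℝ} (hq : Measurable q) (t : ℝ) :
    MemLp (fun x => (Circle.exp (t * q x) : ℂ)) ⊤ ν :=
  memLp_top_of_bound (by fun_prop) 1 (ae_of_all _ fun x => (Circle.norm_coe _).le)

theorem isContractionGroup_mulOperator_circleExp (hp : p ≠ ⊤) {q : α → ℝ} (hq : Measurable q) :
    IsContractionGroup fun t => mulOperator p (memLp_circleExp (ν := ν) hq t) where
  toStronglyContinuousWith := stronglyContinuousWith_mulOperator hp _
    (fun _ => ae_of_all _ fun _ => (Circle.norm_coe _).le) (ae_of_all _ fun _ => by fun_prop)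
  map_zero := mulOperator_eq_id _ (ae_of_all _ fun x => by simp)
  map_add s t := mulOperator_mul _ _ _ (ae_of_all _ fun x => by
    simp [add_mul, Circle.exp_add, -Circle.coe_exp])

end Multiplication

section FreeGroup

variable {d : ℕ}

theorem mulL2_eq_mulOperator {a : Pos d → ℂ} (ha : MemLp a ⊤ volume) (f : L2Space d) :
    mulL2 a f = mulOperator 2 ha f := by
  have hmem : MemLp (fun x => a x * f x) 2 volume :=
    (memLp_congr_ae (coeFn_mulOperator ha f)).1 (Lp.memLp _)
  rw [mulL2, dif_pos hmem]
  exact Lp.ext (hmem.coeFn_toLp.trans (coeFn_mulOperator ha f).symm)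

/-- The symbol `-k · M k / 2` of `div(M ∇) / 2`, with `k = 2π ξ`. -/
def massSymbol (M : Matrix (Fin d) (Fin d) ℝ) (ξ : Pos d) : ℝ :=
  -(((2 * Real.pi) • ξ).ofLp ⬝ᵥ M.mulVec ((2 * Real.pi) • ξ).ofLp) / 2

theorem measurable_massSymbol (M : Matrix (Fin d) (Fin d) ℝ) : Measurable (massSymbol M) := by
  refine Continuous.measurable ?_
  unfold massSymbol dotProduct Matrix.mulVec dotProduct
  fun_prop

/-- The free group `freeGroup M` as a family of bounded operators. -/
def freeOperator (M : Matrix (Fin d) (Fin d) ℝ) (t : ℝ) : L2Space d →L[ℂ] L2Space d :=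
  ((Lp.fourierTransformₗᵢ (Pos d) ℂ).symm : L2Space d →L[ℂ] L2Space d) ∘L
    mulOperator 2 (memLp_circleExp (measurable_massSymbol M) t) ∘L
      (Lp.fourierTransformₗᵢ (Pos d) ℂ : L2Space d →L[ℂ] L2Space d)

theorem isContractionGroup_freeOperator (M : Matrix (Fin d) (Fin d) ℝ) :
    IsContractionGroup (freeOperator M) :=
  (isContractionGroup_mulOperator_circleExp (p := 2) ENNReal.ofNat_ne_top
    (measurable_massSymbol M)).conj_linearIsometryEquiv _

theorem freeOperator_apply (M : Matrix (Fin d) (Fin d) ℝ) (t : ℝ) (f : L2Space d) :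
    freeOperator M t f = freeGroup M t f := by
  have hsymbol : (fun ξ : Pos d => Complex.exp (-(Complex.I * (t / 2 : ℝ) *
      (((2 * Real.pi) • ξ).ofLp ⬝ᵥ M.mulVec ((2 * Real.pi) • ξ).ofLp : ℝ))))
      = fun ξ => (Circle.exp (t * massSymbol M ξ) : ℂ) := by
    ext ξ
    rw [Circle.coe_exp, massSymbol]
    push_cast
    ring_nf
  rw [freeGroup, hsymbol, mulL2_eq_mulOperator (memLp_circleExp (measurable_massSymbol M) t)]
  rfl

end FreeGroup

/-! ### Tensor products with an orthonormal family -/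

section Tensor

variable {α β κ : Type*} [MeasurableSpace α] [MeasurableSpace β] {μ : Measure α} {ν : Measure β}
  {w w' : β → ℂ} {a : α × β → ℂ}

/-- The matrix element `x ↦ ∫ conj(w(z)) w'(z) a(x, z) dν(z)` of a function `a` on a product. -/
def matrixElement (ν : Measure β) (w w' : β → ℂ) (a : α × β → ℂ) (x : α) : ℂ :=
  ∫ z, conj (w z) * w' z * a (x, z) ∂ν

theorem memLp_top_matrixElement [SFinite ν] (hw : MemLp w 2 ν) (hw' : MemLp w' 2 ν)
    (ha : MemLp a ⊤ (μ.prod ν)) : MemLp (matrixElement ν w w' a) ⊤ μ := by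
  have hmeas : AEStronglyMeasurable (fun p : α × β => conj (w p.2) * w' p.2 * a p) (μ.prod ν) :=
    ((Complex.continuous_conj.comp_aestronglyMeasurable hw.1.comp_snd).mul hw'.1.comp_snd).mul ha.1
  refine memLp_top_of_bound hmeas.integral_prod_right'
    (∫ z, ‖w z‖ * ‖w' z‖ * lpNorm a ⊤ (μ.prod ν) ∂ν) ?_
  filter_upwards [Measure.ae_ae_of_ae_prod (ae_le_lpNorm_exponent_top ha)] with x hx
  refine norm_integral_le_of_norm_le ((hw.norm.integrable_mul hw'.norm).mul_const _) ?_
  filter_upwards [hx] with z hz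
  rw [norm_mul, norm_mul, RCLike.norm_conj]
  gcongr

theorem memLp_two_tensor {f : α → ℂ} (hf : MemLp f 2 μ) (hw : MemLp w 2 ν) :
    MemLp (fun p : α × β => f p.1 * w p.2) 2 (μ.prod ν) := by
  refine (memLp_two_iff_integrable_sq_norm (hf.1.comp_fst.mul hw.1.comp_snd)).2 ?_
  simp only [Pi.mul_apply, norm_mul, mul_pow]
  exact ((memLp_two_iff_integrable_sq_norm hf.1).1 hf).mul_prod
    ((memLp_two_iff_integrable_sq_norm hw.1).1 hw)

/-- The map `f ↦ f ⊗ w` from `L²(μ)` to `L²(μ × ν)`. -/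
def tensorRight (μ : Measure α) [SFinite μ] (hw : MemLp w 2 ν) :
    Lp ℂ 2 μ →ₗ[ℂ] Lp ℂ 2 (μ.prod ν) where
  toFun f := (memLp_two_tensor (Lp.memLp f) hw).toLp _
  map_add' f g := by
    rw [← MemLp.toLp_add]
    refine MemLp.toLp_congr _ _ ?_
    filter_upwards [Measure.quasiMeasurePreserving_fst.ae (Lp.coeFn_add f g)] with p hp
    rw [hp]
    simp [add_mul]
  map_smul' c f := by
    rw [RingHom.id_apply, ← MemLp.toLp_const_smul]
    refine MemLp.toLp_congr _ _ ?_
    filter_upwards [Measure.quasiMeasurePreserving_fst.ae (Lp.coeFn_smul c f)] with p hp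
    simp [hp, mul_assoc]

theorem coeFn_tensorRight [SFinite μ] (hw : MemLp w 2 ν) (f : Lp ℂ 2 μ) :
    tensorRight μ hw f =ᵐ[μ.prod ν] fun p => f p.1 * w p.2 :=
  (memLp_two_tensor (Lp.memLp f) hw).coeFn_toLp

variable [SFinite μ] [SFinite ν]

theorem inner_tensorRight (hw : MemLp w 2 ν) (hw' : MemLp w' 2 ν) (f g : Lp ℂ 2 μ) :
    inner ℂ (tensorRight μ hw f) (tensorRight μ hw' g)
      = inner ℂ f g * ∫ z, conj (w z) * w' z ∂ν := by
  rw [L2.inner_def, L2.inner_def, ← integral_prod_mul]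
  refine integral_congr_ae ?_
  filter_upwards [coeFn_tensorRight hw f, coeFn_tensorRight hw' g] with p hf hg
  rw [hf, hg]
  simp only [RCLike.inner_apply, map_mul]
  ring

theorem inner_tensorRight_mulOperator (hw : MemLp w 2 ν) (hw' : MemLp w' 2 ν)
    (ha : MemLp a ⊤ (μ.prod ν)) (f g : Lp ℂ 2 μ) :
    inner ℂ (tensorRight μ hw f) (mulOperator 2 ha (tensorRight μ hw' g))
      = inner ℂ f (mulOperator 2 (memLp_top_matrixElement hw hw' ha) g) := by
  have hprod : (fun p => inner ℂ (tensorRight μ hw f p) (mulOperator 2 ha (tensorRight μ hw' g) p))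
      =ᵐ[μ.prod ν] fun p => (g p.1 * conj (f p.1)) * (conj (w p.2) * w' p.2 * a p) := by
    filter_upwards [coeFn_tensorRight hw f, coeFn_tensorRight hw' g,
      coeFn_mulOperator ha (tensorRight μ hw' g)] with p hf hg hag
    rw [hf, hag, hg]
    simp only [RCLike.inner_apply, map_mul]
    ring
  rw [L2.inner_def, L2.inner_def, integral_congr_ae hprod,
    integral_prod _ ((L2.integrable_inner (𝕜 := ℂ) _ _).congr hprod)]
  refine integral_congr_ae ?_
  filter_upwards [coeFn_mulOperator (memLp_top_matrixElement hw hw' ha) g] with x hx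
  rw [hx, integral_const_mul, ← matrixElement, RCLike.inner_apply]
  ring

variable [DecidableEq κ] {v : κ → β → ℂ} (hv : ∀ n, MemLp (v n) 2 ν)
  (horth : ∀ n m, ∫ z, conj (v n z) * v m z ∂ν = if n = m then 1 else 0)

/-- The isometry `f ↦ f ⊗ v_n`, for an orthonormal family `v`. -/
def tensorIsometry (μ : Measure α) [SFinite μ] (n : κ) : Lp ℂ 2 μ →ₗᵢ[ℂ] Lp ℂ 2 (μ.prod ν) :=
  (tensorRight μ (hv n)).isometryOfInner fun f g => by
    rw [inner_tensorRight, horth n n, if_pos rfl, mul_one]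

theorem orthogonalFamily_tensorIsometry :
    OrthogonalFamily ℂ (fun _ : κ => Lp ℂ 2 μ) (tensorIsometry hv horth μ) :=
  fun n m hnm f g => (inner_tensorRight (hv n) (hv m) f g).trans (by
    rw [horth n m, if_neg hnm, mul_zero])

/-- The isometry `(f_n) ↦ ∑ f_n ⊗ v_n`, for an orthonormal family `v`. -/
def tensorSum (μ : Measure α) [SFinite μ] :
    lp (fun _ : κ => Lp ℂ 2 μ) 2 →L[ℂ] Lp ℂ 2 (μ.prod ν) :=
  (orthogonalFamily_tensorIsometry hv horth).linearIsometry.toContinuousLinearMap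

theorem tensorSum_single (n : κ) (f : Lp ℂ 2 μ) :
    tensorSum hv horth μ (lp.single 2 n f) = tensorRight μ (hv n) f :=
  (orthogonalFamily_tensorIsometry hv horth).linearIsometry_apply_single f

/-- The compression of multiplication by `a` to the range of `(f_n) ↦ ∑ f_n ⊗ v_n`; its matrix
elements are multiplications by `∫ conj(v_n) v_m a(x, ·)`. -/
def compressedMultiplication (ha : MemLp a ⊤ (μ.prod ν)) :
    lp (fun _ : κ => Lp ℂ 2 μ) 2 →L[ℂ] lp (fun _ : κ => Lp ℂ 2 μ) 2 :=
  (tensorSum hv horth μ).adjoint ∘L mulOperator 2 ha ∘L tensorSum hv horth μ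

theorem compressedMultiplication_single (ha : MemLp a ⊤ (μ.prod ν)) (n m : κ) (g : Lp ℂ 2 μ) :
    compressedMultiplication hv horth ha (lp.single 2 m g) n
      = mulOperator 2 (memLp_top_matrixElement (hv n) (hv m) ha) g := by
  refine ext_inner_left ℂ fun f => ?_
  rw [← lp.inner_single_left (𝕜 := ℂ) (G := fun _ : κ => Lp ℂ 2 μ)]
  simp only [compressedMultiplication, ContinuousLinearMap.comp_apply,
    ContinuousLinearMap.adjoint_inner_right, tensorSum_single]
  exact inner_tensorRight_mulOperator (hv n) (hv m) ha f g

end Tensor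

/-! ### The envelope function systems -/

section EnvelopeSystems

variable {d : ℕ}

/-- The unitary group on `ℓ²(ℕ, L²(ℝ^d))` that acts as `exp (i t/2 div(M_n ∇))` on the `n`-th
component. -/
def envelopeGroup (M : ℕ → Matrix (Fin d) (Fin d) ℝ) (t : ℝ) : EnvSpace d →L[ℂ] EnvSpace d :=
  lp.mapCLM 2 (fun n => freeOperator (M n) t) (NNReal.coe_nonneg 1)
    fun n => (isContractionGroup_freeOperator (M n)).norm_le t

theorem isContractionGroup_envelopeGroup (M : ℕ → Matrix (Fin d) (Fin d) ℝ) :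
    IsContractionGroup (envelopeGroup M) :=
  .lpMap ENNReal.ofNat_ne_top fun n => isContractionGroup_freeOperator (M n)

theorem envelopeGroup_apply (M : ℕ → Matrix (Fin d) (Fin d) ℝ) (t : ℝ) (h : EnvSpace d) (n : ℕ) :
    envelopeGroup M t h n = freeGroup (M n) t (h n) :=
  freeOperator_apply (M n) t (h n)

section Bridge

variable {M : ℕ → Matrix (Fin d) (Fin d) ℝ} {B : ℝ → EnvSpace d → ℕ → L2Space d}
  {T : ℝ → EnvSpace d →L[ℂ] EnvSpace d} {C : ℝ≥0}

theorem integral_envelopeGroup_apply (hT : StronglyContinuousWith C T)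
    (hTB : ∀ t h n, T t h n = -Complex.I • B t h n) {h : ℝ → EnvSpace d}
    (hh : ContinuousOn h (Ici 0)) {t : ℝ} (ht : 0 ≤ t) (n : ℕ) :
    (∫ s in (0 : ℝ)..t, envelopeGroup M (t - s) (T s (h s))) n
      = -(Complex.I • ∫ s in (0 : ℝ)..t, freeGroup (M n) (t - s) (B s (h s) n)) := by
  have hint : IntervalIntegrable (fun s => envelopeGroup M (t - s) (T s (h s))) volume 0 t := by
    refine ContinuousOn.intervalIntegrable ?_
    rw [uIcc_of_le ht, continuousOn_iff_continuous_domRestrict]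
    exact ((isContractionGroup_envelopeGroup M).comp_continuous
      (by fun_prop : Continuous fun s : Icc 0 t => t - (s : ℝ))).continuous_apply
      ((hT.comp_continuous continuous_subtype_val).continuous_apply
        (hh.comp_continuous continuous_subtype_val fun s => mem_Ici.2 s.2.1))
  refine ((lp.evalCLM ℂ (fun _ : ℕ => L2Space d) 2 n).intervalIntegral_comp_comm hint).symm.trans ?_
  rw [← neg_smul, ← intervalIntegral.integral_smul]
  refine intervalIntegral.integral_congr fun s _ => ?_
  change envelopeGroup M (t - s) (T s (h s)) n = _
  simp only [envelopeGroup_apply, hTB, ← freeOperator_apply, map_smul]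

theorem isMildSolution_iff_isMild (hT : StronglyContinuousWith C T)
    (hTB : ∀ t h n, T t h n = -Complex.I • B t h n) {f : EnvSpace d} {h : ℝ → EnvSpace d} :
    IsMildSolution M B f h ↔ IsMild (envelopeGroup M) T f h := by
  refine ⟨fun ⟨hc, hh⟩ => ⟨hc, fun t ht => lp.ext (funext fun n => ?_)⟩,
    fun ⟨hc, hh⟩ => ⟨hc, fun t ht n => ?_⟩⟩
  · rw [hh t ht n, lp.coeFn_add, Pi.add_apply, envelopeGroup_apply, sub_eq_add_neg,
      integral_envelopeGroup_apply hT hTB hc ht]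
  · rw [hh t ht, lp.coeFn_add, Pi.add_apply, envelopeGroup_apply, sub_eq_add_neg,
      integral_envelopeGroup_apply hT hTB hc ht]

theorem hasUniqueMildSolution_of_stronglyContinuousWith (hT : StronglyContinuousWith C T)
    (hTB : ∀ t h n, T t h n = -Complex.I • B t h n) (f : EnvSpace d) :
    HasUniqueMildSolution M B f := by
  have hU := isContractionGroup_envelopeGroup M
  obtain ⟨h, hh⟩ := exists_isMild hU hT f
  exact ⟨h, (isMildSolution_iff_isMild hT hTB).2 hh, fun h' hh' =>
    hh.eqOn hU hT ((isMildSolution_iff_isMild hT hTB).1 hh')⟩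

end Bridge

section Couplings

variable {u : ℕ → ℕ → Pos d → ℂ} {A : EnvSpace d →L[ℂ] EnvSpace d}

theorem phaseConj_apply_eq_smul_oscillatingCoupling {c : ℂ}
    (hA : ∀ n m g, A (lp.single 2 m g) n = c • mulL2 (u n m) g) (E : ℕ → ℝ) (ε t : ℝ)
    (h : EnvSpace d) (n : ℕ) :
    phaseConj E A ((ε ^ 2)⁻¹ * t) h n = c • oscillatingCoupling E u ε t h n := by
  set r := (ε ^ 2)⁻¹ * t with hr
  have hsum := ((lp.hasSum_single ENNReal.ofNat_ne_top (phaseGroup E (-r) h)).mapL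
    (lp.evalCLM ℂ (fun _ : ℕ => L2Space d) 2 n ∘L phaseGroup E r ∘L A)).tsum_eq
  refine hsum.symm.trans ?_
  rw [oscillatingCoupling, ← tsum_const_smul'']
  refine tsum_congr fun m => ?_
  change phaseGroup E r (A (lp.single 2 m (phaseGroup E (-r) h m))) n = _
  rw [phaseGroup_apply, phaseGroup_apply, lp.single_smul, map_smul, lp.coeFn_smul, Pi.smul_apply,
    hA, smul_smul, smul_comm c, ← Circle.coe_mul, ← Circle.exp_add, Circle.coe_exp]
  congr 2
  rw [hr]
  push_cast
  ring

theorem diagonalPart_apply_eq_smul_diagonalCoupling {c : ℂ}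
    (hA : ∀ n m g, A (lp.single 2 m g) n = c • mulL2 (u n m) g) (t : ℝ) (h : EnvSpace d) (n : ℕ) :
    diagonalPart A h n = c • diagonalCoupling u t h n :=
  (diagonalPart_apply A h n).trans (hA n n (h n))

end Couplings

end EnvelopeSystems

theorem theorem5p7_general {d : ℕ} {Z : Type*} [MeasurableSpace Z] {ν : Measure Z} [SFinite ν]
    (M : ℕ → Matrix (Fin d) (Fin d) ℝ) {E : ℕ → ℝ} (hE : Function.Injective E)
    {v : ℕ → Z → ℂ} (hv : ∀ n, MemLp (v n) 2 ν)
    (horth : ∀ n m, ∫ z, conj (v n z) * v m z ∂ν = if n = m then 1 else 0)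
    {a : Pos d × Z → ℂ} (ha : MemLp a ⊤ (volume.prod ν)) {fε : ℝ → EnvSpace d} {f : EnvSpace d}
    (hlim : Tendsto fε (𝓝[>] 0) (𝓝 f)) :
    (∀ ε, 0 < ε → HasUniqueMildSolution M
      (oscillatingCoupling E (fun n m => matrixElement ν (v n) (v m) a) ε) (fε ε)) ∧
    HasUniqueMildSolution M (diagonalCoupling fun n m => matrixElement ν (v n) (v m) a) f ∧
    ∀ (hε : ℝ → ℝ → EnvSpace d) (h : ℝ → EnvSpace d),
      (∀ ε, 0 < ε → IsMildSolution M
        (oscillatingCoupling E (fun n m => matrixElement ν (v n) (v m) a) ε) (fε ε) (hε ε)) →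
      IsMildSolution M (diagonalCoupling fun n m => matrixElement ν (v n) (v m) a) f h →
      ∀ τ, TendstoUniformlyOn hε h (𝓝[>] 0) (Icc 0 τ) := by
  have h2 : (2 : ℝ≥0∞) ≠ ⊤ := ENNReal.ofNat_ne_top
  have hU := isContractionGroup_envelopeGroup M
  set A : EnvSpace d →L[ℂ] EnvSpace d := -Complex.I • compressedMultiplication hv horth ha
  have hA (n m : ℕ) (g : L2Space d) :
      A (lp.single 2 m g) n = -Complex.I • mulL2 (matrixElement ν (v n) (v m) a) g :=
    congrArg (-Complex.I • ·) ((compressedMultiplication_single hv horth ha n m g).trans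
      (mulL2_eq_mulOperator _ g).symm)
  have hosc (ε : ℝ) : StronglyContinuousWith ‖A‖₊ fun t => phaseConj E A ((ε ^ 2)⁻¹ * t) :=
    (stronglyContinuousWith_phaseConj h2 E A).comp_continuous (by fun_prop)
  have hoscA := phaseConj_apply_eq_smul_oscillatingCoupling hA E
  have hdiag : StronglyContinuousWith _ fun _ : ℝ => diagonalPart A := .const _
  have hdiagA := diagonalPart_apply_eq_smul_diagonalCoupling hA
  refine ⟨fun ε _ => hasUniqueMildSolution_of_stronglyContinuousWith (hosc ε) (hoscA ε) _,
    hasUniqueMildSolution_of_stronglyContinuousWith hdiag hdiagA _, fun hε h hhε hh τ => ?_⟩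
  have havg := (averagesToZero_phaseConj_sub_diagonalPart h2
    (hU.comp_continuous continuous_neg) hE A).comp_tendsto tendsto_inv_sq_nhdsGT_zero
  refine IsMild.tendstoUniformlyOn hU hosc hdiag havg hlim ?_
    ((isMildSolution_iff_isMild hdiag hdiagA).1 hh) τ
  filter_upwards [self_mem_nhdsWithin] with ε hpos
  exact (isMildSolution_iff_isMild (hosc ε) (hoscA ε)).1 (hhε ε hpos)

theorem MemPotentialClass.memLp_prod_restrict_cell {d : ℕ} {L : Matrix (Fin d) (Fin d) ℝ} {μ : ℝ}
    {V : Pos d → Pos d → ℝ} (hV : MemPotentialClass L μ V) :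
    MemLp (fun p : Pos d × Pos d => (V p.1 p.2 : ℂ)) ⊤
      ((volume : Measure (Pos d)).prod (volume.restrict (cell L))) := by
  have h := (hV.1.ofReal (K := ℂ)).restrict (univ ×ˢ cell L)
  rwa [Measure.volume_eq_prod, ← Measure.prod_restrict, Measure.restrict_univ] at h

end

theorem theorem5p7 {d : ℕ} (L : Matrix (Fin d) (Fin d) ℝ) (hL : L.det ≠ 0)
    (W : Pos d → ℝ) (hW : MemLp W ⊤ volume) (hWper : LatticePeriodic L W)
    (E : ℕ → ℝ) (v : ℕ → Pos d → ℂ) (Dv : ℕ → Fin d → Pos d → ℂ)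
    (hBloch : IsBlochSystem L W E v Dv)
    (μ : ℝ) (hμ : 0 < μ)
    (V : Pos d → Pos d → ℝ) (hV : MemPotentialClass L μ V)
    (fε : ℝ → EnvSpace d) (f : EnvSpace d)
    (hbdd : ∃ K : ℝ≥0, ∀ᶠ ε in 𝓝[>] (0 : ℝ), sobolevNormSq μ (fε ε) ≤ K)
    (hlim : Tendsto (fun ε => ‖fε ε - f‖) (𝓝[>] (0 : ℝ)) (𝓝 0)) :
    (∀ ε : ℝ, 0 < ε → HasUniqueMildSolution (inverseMass L E v Dv)
      (oscillatingCoupling E (potentialMatrix L v V) ε) (fε ε)) ∧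
    HasUniqueMildSolution (inverseMass L E v Dv)
      (diagonalCoupling (potentialMatrix L v V)) f ∧
    ∀ (hε : ℝ → ℝ → EnvSpace d) (h : ℝ → EnvSpace d),
      (∀ ε : ℝ, 0 < ε → IsMildSolution (inverseMass L E v Dv)
        (oscillatingCoupling E (potentialMatrix L v V) ε) (fε ε) (hε ε)) →
      IsMildSolution (inverseMass L E v Dv)
        (diagonalCoupling (potentialMatrix L v V)) f h →
      ∀ τ : ℝ, TendstoUniformlyOn hε h (𝓝[>] (0 : ℝ)) (Icc 0 τ) :=
  theorem5p7_general (inverseMass L E v Dv) hBloch.strictMono.injective hBloch.memLp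
    hBloch.orthonormal hV.memLp_prod_restrict_cell (tendsto_iff_norm_sub_tendsto_zero.2 hlim)
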